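/- Let $K$ be an infinite field (of any characteristic), let $G$ be a group with identity $\epsilon$, let $n\ge 1$, and let $g_1,\dots,g_n\in G$ be pairwise distinct. Give $M_n(K)$ the elementary $G$-grading induced by $(g_1,\dots,g_n)$: the component $(M_n(K))_h$ of degree $h\in G$ is spanned by the matrix units $E_{ij}$ with $g_i^{-1}g_j=h$. Let $K\langle X\rangle$ be the free associative algebra (with unit) on $X=\bigcup_{h\in G}X_h$, where the $X_h$ are disjoint countably infinite sets; a variable $x\in X_h$ has degree $h(x)=h$, and $K\langle X\rangle$ is graded by giving a monomial $x_{i_1}\cdots x_{i_k}$ the degree $h(x_{i_1})\cdots h(x_{i_k})$. A polynomial in $K\langle X\rangle$ is a graded identity of $M_n(K)$ if it vanishes under every substitution of elements of $(M_n(K))_{h(x)}$ for the variables $x$. A $T_G$-ideal is a two-sided ideal of $K\langle X\rangle$ invariant under all graded endomorphisms of $K\langle X\rangle$, and a set is a basis of the graded identities of $M_n(K)$ if the smallest $T_G$-ideal containing it is the set of all graded identities of $M_n(K)$. Then the graded identities of $M_n(K)$ have a basis consisting of 1. $x_1x_2-x_2x_1$ with $h(x_1)=h(x_2)=\epsilon$;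 2. $x_1x_3x_2-x_2x_3x_1$ with $h(x_1)=h(x_2)=h(x_3)^{-1}\neq\epsilon$ (one for each value of $h(x_1)\in G\setminus\{\epsilon\}$); 3. $x_1$ for each degree $h(x_1)=h\in G$ with $(M_n(K))_{h}=0$; 4. finitely many monomials $x_{i_1}x_{i_2}\cdots x_{i_k}$, each of length $2\le k\le 4n^{4(n^2+1)}$. In particular the length of the monomials in 4 is bounded by a function of $n$ alone. -/

import Mathlib

namespace GradedPI

noncomputable section

/-- The free associative algebra `K⟨X⟩`, where `X` is the disjoint union of the countably infinite
sets `X_h = {(h, 0), (h, 1), (h, 2), …}`, `h ∈ G`; the variable `(h, i)` has degree `h`. -/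
abbrev FreeGraded (K : Type*) [Field K] (G : Type*) : Type _ :=
  FreeAlgebra K (G × ℕ)

/-- The `i`-th variable of degree `h`. -/
def var (K : Type*) [Field K] {G : Type*} (h : G) (i : ℕ) : FreeGraded K G :=
  FreeAlgebra.ι K (h, i)

/-- The monomial `x_{i_1} ⋯ x_{i_k}` attached to a word `[x_{i_1}, …, x_{i_k}]` in the variables. -/
def monomial (K : Type*) [Field K] {G : Type*} (w : List (G × ℕ)) : FreeGraded K G :=
  (w.map (FreeAlgebra.ι K)).prod

/-- The homogeneous component `K⟨X⟩_g`: the subspace spanned by the monomials `x_{i_1} ⋯ x_{i_k}`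
with `h_1 ⋯ h_k = g`, where `h_l` is the degree of `x_{i_l}`. -/
def freeComponent (K : Type*) [Field K] {G : Type*} [Group G] (g : G) :
    Submodule K (FreeGraded K G) :=
  Submodule.span K {m | ∃ w : List (G × ℕ), (w.map Prod.fst).prod = g ∧ m = monomial K w}

/-- A graded endomorphism of `K⟨X⟩`. -/
def IsGradedEnd {K : Type*} [Field K] {G : Type*} [Group G]
    (φ : FreeGraded K G →ₐ[K] FreeGraded K G) : Prop :=
  ∀ g : G, ∀ f ∈ freeComponent K g, φ f ∈ freeComponent K g

/-- A `T_G`-ideal: a two-sided ideal of `K⟨X⟩` invariant under all graded endomorphisms. -/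
def IsTGIdeal {K : Type*} [Field K] {G : Type*} [Group G]
    (I : TwoSidedIdeal (FreeGraded K G)) : Prop :=
  ∀ φ : FreeGraded K G →ₐ[K] FreeGraded K G, IsGradedEnd φ → ∀ f ∈ I, φ f ∈ I

/-- The `T_G`-ideal generated by `S`: the intersection of all `T_G`-ideals containing `S`. -/
def tgSpan {K : Type*} [Field K] {G : Type*} [Group G] (S : Set (FreeGraded K G)) :
    TwoSidedIdeal (FreeGraded K G) :=
  sInf {I | IsTGIdeal I ∧ ∀ f ∈ S, f ∈ I}

/-- The set `T_G(A)` of graded polynomial identities of an algebra `A` with homogeneous components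
`𝓐 h`: the polynomials that vanish whenever every variable of degree `h` is replaced by an element
of `𝓐 h`. -/
def gradedIdentities {K : Type*} [Field K] {G : Type*} {A : Type*} [Ring A] [Algebra K A]
    (𝓐 : G → Submodule K A) : Set (FreeGraded K G) :=
  {f | ∀ a : G × ℕ → A, (∀ x : G × ℕ, a x ∈ 𝓐 x.1) → FreeAlgebra.lift K a f = 0}

/-- `S` is a basis of the graded identities: `T_G(A)` is the `T_G`-ideal generated by `S`. -/
def IsBasisOfIdentities {K : Type*} [Field K] {G : Type*} [Group G] {A : Type*} [Ring A]
    [Algebra K A] (𝓐 : G → Submodule K A) (S : Set (FreeGraded K G)) : Prop :=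
  gradedIdentities 𝓐 = {f | f ∈ tgSpan S}

/-- The elementary `G`-grading of `M_n(K)` induced by `(g_1, …, g_n)`: the component of degree `h`
is spanned by the matrix units `E_{ij}` with `g_i⁻¹ g_j = h`. -/
def elementary (K : Type*) [Field K] {G : Type*} [Group G] {n : ℕ} (g : Fin n → G) (h : G) :
    Submodule K (Matrix (Fin n) (Fin n) K) :=
  Submodule.span K {E | ∃ i j : Fin n, (g i)⁻¹ * g j = h ∧ E = Matrix.single i j (1 : K)}

/-- `x₁x₂ - x₂x₁`, where `x₁, x₂` have the neutral degree. -/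
def neutralCommutators (K : Type*) [Field K] (G : Type*) [Group G] : Set (FreeGraded K G) :=
  {var K 1 1 * var K 1 2 - var K 1 2 * var K 1 1}

/-- `x₁x₃x₂ - x₂x₃x₁`, where `x₁, x₂` have degree `h ≠ 1` and `x₃` has degree `h⁻¹`. -/
def inverseDegreeRelations (K : Type*) [Field K] (G : Type*) [Group G] : Set (FreeGraded K G) :=
  {f | ∃ h : G, h ≠ 1 ∧
    f = var K h 1 * var K h⁻¹ 3 * var K h 2 - var K h 2 * var K h⁻¹ 3 * var K h 1}

/-- The variables `x₁` whose degree `h` satisfies `A_h = 0`. -/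
def zeroComponentVariables {K : Type*} [Field K] {G : Type*} {A : Type*} [Ring A]
    [Algebra K A] (𝓐 : G → Submodule K A) : Set (FreeGraded K G) :=
  {f | ∃ h : G, 𝓐 h = ⊥ ∧ f = var K h 1}

end

end GradedPI

/-! A word in the variables describes, from each vertex of `G`, a walk whose steps are right
multiplications by degrees. As the `g i` are distinct, a homogeneous matrix has at most one nonzero
entry per row. So row `i` of the value of a word is zero if its walk from `g i` leaves the image of
`g`; otherwise its one possibly nonzero entry is a product over the edges of that walk. Over an
infinite field, the coefficients in an identity must therefore sum to zero over the words sharing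
one multiset of edges that stays in the image (`sum_coeff_eq_zero`).

Such words are congruent modulo relations 1 and 2: two walks from one vertex with the same edges
differ by exchanges of parallel pieces (`rel_of_edges_eq`), and those relations allow each exchange.
What remains are words whose walks from all `g i` leave the image. One escaping prefix for each `i`
cuts such a word into at most `n + 2` blocks, and the word is a substitution instance of a monomial
with one variable per block (`monomial_mem_tgSpan`). -/

namespace GradedPI

/-! ### Walks in `G` and exchanges of parallel pieces. -/

section Walks

variable {G : Type*} [Group G] {β : Type*}

/-- The product of the degrees of the letters of a word. -/
def wordDegree (w : List (G × β)) : G := (w.map Prod.fst).prod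

@[simp] lemma wordDegree_nil : wordDegree ([] : List (G × β)) = 1 := rfl

@[simp] lemma wordDegree_cons (x : G × β) (w : List (G × β)) :
    wordDegree (x :: w) = x.1 * wordDegree w := by
  simp [wordDegree]

@[simp] lemma wordDegree_append (u w : List (G × β)) :
    wordDegree (u ++ w) = wordDegree u * wordDegree w := by
  simp [wordDegree]

/-- The edges of the walk in `G` that starts at `γ` and whose steps are the right multiplications
by the degrees of the letters of a word. An edge is a pair (initial vertex, letter). -/
def edges : G → List (G × β) → Multiset (G × (G × β))
  | _, [] => 0
  | γ, x :: w => (γ, x) ::ₘ edges (γ * x.1) w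

@[simp] lemma edges_nil (γ : G) : edges γ ([] : List (G × β)) = 0 := rfl

@[simp] lemma edges_cons (γ : G) (x : G × β) (w : List (G × β)) :
    edges γ (x :: w) = (γ, x) ::ₘ edges (γ * x.1) w := rfl

lemma edges_append (γ : G) (u w : List (G × β)) :
    edges γ (u ++ w) = edges γ u + edges (γ * wordDegree u) w := by
  induction u generalizing γ with
  | nil => simp
  | cons x u ih => simp [ih, mul_assoc]

lemma mem_edges {γ : G} {e : G × (G × β)} {w : List (G × β)} :
    e ∈ edges γ w ↔ ∃ u v, w = u ++ e.2 :: v ∧ γ * wordDegree u = e.1 := by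
  constructor
  · induction w generalizing γ with
    | nil => simp
    | cons x w ih =>
      intro h
      rcases Multiset.mem_cons.1 h with h | h
      · exact ⟨[], w, by simp [h], by simp [h]⟩
      · obtain ⟨u, v, rfl, hv⟩ := ih h
        exact ⟨x :: u, v, by simp, by simpa [mul_assoc] using hv⟩
  · rintro ⟨u, v, rfl, hv⟩
    simp [edges_append, hv]

/-- Exchanging two parallel pieces of a walk does not change its edges. -/
lemma edges_exchange (γ : G) {p q r : List (G × β)} (hr : wordDegree p = wordDegree r)
    (hq : wordDegree p * wordDegree q = 1) :
    edges γ (p ++ q ++ r) = edges γ (r ++ q ++ p) := by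
  -- Both `p ++ q` and `r ++ q` are closed, so in either order `p` and `r` start at `γ` and `q`
  -- starts at `γ * wordDegree p`.
  have h : wordDegree r * wordDegree q = 1 := hr ▸ hq
  simp only [edges_append, wordDegree_append, h, hr, mul_one]
  abel

/-- If a closed walk `v₁` at `γ`, continued by the step `x` and the walk `v₂`, has the same edges
as a walk `x :: u` that returns to `γ`, then `v₁` and `v₂` have a common vertex. -/
lemma exists_common_vertex {γ : G} {x y : G × β} {u v₁ v₂ : List (G × β)}
    (h : edges γ (x :: u) = edges γ (y :: v₁ ++ x :: v₂)) (hxy : y ≠ x)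
    (h₁ : wordDegree (y :: v₁) = 1) :
    ∃ p q r s, y :: v₁ = p ++ q ∧ v₂ = r ++ s ∧ wordDegree p = x.1 * wordDegree r := by
  by_contra! hne
  -- Without a common vertex, `u` is trapped among the vertices of `v₂`: its next edge starts at one
  -- of them, so it is neither an edge of the closed walk nor `(γ, x)`, and must come from `v₂`. But
  -- `u` also has to use the edge `(γ, y)`.
  have key : ∀ p s : List (G × β), u = p ++ s →
      ∃ r t, v₂ = r ++ t ∧ wordDegree p = wordDegree r := by
    intro p
    induction p using List.reverseRecOn with
    | nil => exact fun s _ => ⟨[], v₂, rfl, rfl⟩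
    | append_singleton p z ih =>
      intro s hs
      obtain ⟨r, t, ht, hrt⟩ := ih (z :: s) (by simp [hs])
      have hmem : (γ * x.1 * wordDegree p, z) ∈ edges γ (x :: u) :=
        mem_edges.2 ⟨x :: p, s, by simp [hs], by simp [mul_assoc]⟩
      rw [h, edges_append, Multiset.mem_add, h₁, mul_one, edges_cons _ x v₂,
        Multiset.mem_cons] at hmem
      rcases hmem with hmem | hmem | hmem
      · obtain ⟨a, b, hab, ha⟩ := mem_edges.1 hmem
        refine absurd ?_ (hne a (z :: b) r t hab ht)
        simpa [mul_assoc, hrt] using ha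
      · refine absurd ?_ (hne [] (y :: v₁) r t rfl ht)
        have := congrArg Prod.fst hmem
        simpa [mul_assoc, hrt, eq_comm] using this
      · obtain ⟨a, b, hab, ha⟩ := mem_edges.1 hmem
        refine ⟨a ++ [z], b, by simpa using hab, ?_⟩
        have : wordDegree a = wordDegree p := by simpa using ha
        simp [this]
  have hy : (γ, y) ∈ edges γ (x :: u) := by simp [h]
  rw [edges_cons, Multiset.mem_cons] at hy
  rcases hy with hy | hy
  · exact hxy (congrArg Prod.snd hy)
  · obtain ⟨a, b, hab, ha⟩ := mem_edges.1 hy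
    obtain ⟨r, t, ht, hrt⟩ := key a (y :: b) hab
    refine hne [] (y :: v₁) r t rfl ht ?_
    rw [← hrt]
    simpa [mul_assoc, eq_comm] using ha

/-- Two words whose walks from `γ` have the same edges are related by exchanges of parallel
pieces. -/
theorem rel_of_edges_eq {R : List (G × β) → List (G × β) → Prop} (hR : Equivalence R)
    (hcons : ∀ x u w, R u w → R (x :: u) (x :: w))
    (happ : ∀ u w s, R u w → R (u ++ s) (w ++ s))
    (hexch : ∀ p q r, wordDegree p = wordDegree r → wordDegree p * wordDegree q = 1 →
      R (p ++ q ++ r) (r ++ q ++ p))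
    {γ : G} {u w : List (G × β)} (h : edges γ u = edges γ w) : R u w := by
  induction u generalizing γ w with
  | nil =>
    cases w with
    | nil => exact hR.refl _
    | cons y w => exact absurd h.symm (Multiset.cons_ne_zero)
  | cons x u ih =>
    have start : ∀ v, edges γ (x :: u) = edges γ (x :: v) → R (x :: u) (x :: v) :=
      fun v hv => hcons _ _ _ (ih ((Multiset.cons_inj_right _).1 hv))
    have hx : (γ, x) ∈ edges γ w := by simp [← h]
    obtain ⟨v₁, v₂, rfl, hv⟩ := mem_edges.1 hx
    have hv₁ : wordDegree v₁ = 1 := by simpa using hv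
    cases v₁ with
    | nil => exact start _ h
    | cons y v₁ =>
      by_cases hxy : y = x
      · subst hxy
        exact start _ h
      -- Cutting both parts at the common vertex makes `p` and `x :: r` parallel; exchanging them
      -- brings `x` to the front.
      obtain ⟨p, q, r, s, hpq, rfl, hp⟩ := exists_common_vertex h hxy hv₁
      have hp' : wordDegree p = wordDegree (x :: r) := by simpa using hp
      have hq : wordDegree p * wordDegree q = 1 := by rw [← wordDegree_append, ← hpq, hv₁]
      have e : y :: v₁ ++ x :: (r ++ s) = p ++ q ++ (x :: r) ++ s := by simp [hpq]
      have hw : edges γ (p ++ q ++ (x :: r) ++ s) = edges γ ((x :: r) ++ q ++ p ++ s) := by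
        rw [edges_append, edges_exchange γ hp' hq, edges_append _ (_ ++ p)]
        simp only [wordDegree_append, hp']
      rw [e] at h ⊢
      refine hR.trans (start (r ++ q ++ p ++ s) ?_) (hR.symm (happ _ _ _ (hexch p q _ hp' hq)))
      rw [h, hw]
      simp

end Walks

/-! ### Values of words on homogeneous matrices. -/

section Evaluation

section Monomial

variable {K : Type*} [Field K] {G : Type*}

@[simp] lemma monomial_nil : monomial K ([] : List (G × ℕ)) = 1 := rfl

@[simp] lemma monomial_cons (x : G × ℕ) (w : List (G × ℕ)) :
    monomial K (x :: w) = FreeAlgebra.ι K x * monomial K w := by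
  simp [monomial]

@[simp] lemma monomial_append (u w : List (G × ℕ)) :
    monomial K (u ++ w) = monomial K u * monomial K w := by
  simp [monomial]

lemma lift_monomial {A : Type*} [Ring A] [Algebra K A] (a : G × ℕ → A) (w : List (G × ℕ)) :
    FreeAlgebra.lift K a (monomial K w) = (w.map a).prod := by
  induction w with
  | nil => simp
  | cons x w ih => simp [ih]

end Monomial

variable {K : Type*} [Field K] {G : Type*} [Group G]

lemma monomial_mem_freeComponent (w : List (G × ℕ)) :
    monomial K w ∈ freeComponent K (wordDegree w) :=
  Submodule.subset_span ⟨w, rfl, rfl⟩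

lemma ι_mem_freeComponent (x : G × ℕ) : FreeAlgebra.ι K x ∈ freeComponent K x.1 := by
  simpa using monomial_mem_freeComponent (K := K) [x]

/-- A homogeneous substitution maps the homogeneous components of the free algebra into those of
a graded algebra. -/
lemma lift_mem_of_mem_freeComponent {A : Type*} [Ring A] [Algebra K A] (𝓐 : G → Submodule K A)
    (h₁ : (1 : A) ∈ 𝓐 1) (hmul : ∀ h k a b, a ∈ 𝓐 h → b ∈ 𝓐 k → a * b ∈ 𝓐 (h * k))
    {a : G × ℕ → A} (ha : ∀ x, a x ∈ 𝓐 x.1) {h : G} {f : FreeGraded K G}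
    (hf : f ∈ freeComponent K h) : FreeAlgebra.lift K a f ∈ 𝓐 h := by
  have : freeComponent K h ≤ (𝓐 h).comap (FreeAlgebra.lift K a).toLinearMap := by
    refine Submodule.span_le.2 ?_
    rintro _ ⟨w, rfl, rfl⟩
    clear hf
    change FreeAlgebra.lift K a (monomial K w) ∈ 𝓐 (wordDegree w)
    induction w with
    | nil => simpa using h₁
    | cons x w ih => simpa using hmul _ _ _ _ (ha x) ih
  exact this hf

lemma one_mem_freeComponent : (1 : FreeGraded K G) ∈ freeComponent K (1 : G) := by
  simpa using monomial_mem_freeComponent (K := K) ([] : List (G × ℕ))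

lemma mul_mem_freeComponent {h k : G} {a b : FreeGraded K G} (ha : a ∈ freeComponent K h)
    (hb : b ∈ freeComponent K k) : a * b ∈ freeComponent K (h * k) := by
  refine (?_ : freeComponent K h * freeComponent K k ≤ freeComponent K (h * k))
    (Submodule.mul_mem_mul ha hb)
  rw [freeComponent, freeComponent, Submodule.span_mul_span, Submodule.span_le]
  rintro _ ⟨_, ⟨u, rfl, rfl⟩, _, ⟨v, rfl, rfl⟩, rfl⟩
  simpa [wordDegree] using monomial_mem_freeComponent (K := K) (u ++ v)

/-- A homogeneous substitution of the variables extends to a graded endomorphism. -/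
lemma isGradedEnd_lift {b : G × ℕ → FreeGraded K G} (hb : ∀ x, b x ∈ freeComponent K x.1) :
    IsGradedEnd (FreeAlgebra.lift K b) :=
  fun _ _ hf => lift_mem_of_mem_freeComponent _ one_mem_freeComponent
    (fun _ _ _ _ => mul_mem_freeComponent) hb hf

variable {n : ℕ} {g : Fin n → G}

lemma mem_elementary {h : G} {A : Matrix (Fin n) (Fin n) K} :
    A ∈ elementary K g h ↔ ∀ i j, A i j ≠ 0 → g i * h = g j := by
  constructor
  · intro hA
    induction hA using Submodule.span_induction with
    | mem x hx =>
      obtain ⟨i, j, rfl, rfl⟩ := hx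
      intro k l hkl
      rw [Matrix.single_apply] at hkl
      obtain ⟨rfl, rfl⟩ := (ite_ne_right_iff.1 hkl).1
      simp
    | zero => simp
    | add x y _ _ hx hy =>
      intro i j hij
      by_cases h0 : x i j = 0
      · exact hy i j (by simpa [h0] using hij)
      · exact hx i j h0
    | smul c x _ hx =>
      intro i j hij
      exact hx i j (by simp_all)
  · intro hA
    rw [Matrix.matrix_eq_sum_single A]
    refine Submodule.sum_mem _ fun i _ => Submodule.sum_mem _ fun j _ => ?_
    by_cases h0 : A i j = 0
    · simp [h0]
    · have : Matrix.single i j (A i j) = A i j • Matrix.single i j (1 : K) := by simp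
      rw [this]
      refine Submodule.smul_mem _ _ (Submodule.subset_span ⟨i, j, ?_, rfl⟩)
      rw [← hA i j h0]
      simp

lemma one_mem_elementary : (1 : Matrix (Fin n) (Fin n) K) ∈ elementary K g 1 :=
  mem_elementary.2 fun i j hij => by
    rw [Matrix.one_apply] at hij
    simp [(ite_ne_right_iff.1 hij).1]

lemma mul_mem_elementary {h k : G} {A B : Matrix (Fin n) (Fin n) K}
    (hA : A ∈ elementary K g h) (hB : B ∈ elementary K g k) : A * B ∈ elementary K g (h * k) := by
  rw [mem_elementary] at hA hB ⊢
  intro i j hij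
  rw [Matrix.mul_apply] at hij
  obtain ⟨l, -, hl⟩ := Finset.exists_ne_zero_of_sum_ne_zero hij
  rw [← hB l j (right_ne_zero_of_mul hl), ← hA i l (left_ne_zero_of_mul hl), mul_assoc]

lemma elementary_eq_bot {h : G} (hh : ∀ i j, g i * h ≠ g j) : elementary K g h = ⊥ := by
  refine (Submodule.eq_bot_iff _).2 fun A hA => ?_
  ext i j
  by_contra h0
  exact hh i j (mem_elementary.1 hA i j h0)

/-- A set of edges stays in the image of `g` if all its terminal vertices lie in this image. -/
def Stays (g : Fin n → G) (e : Multiset (G × (G × ℕ))) : Prop :=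
  ∀ x ∈ e, x.1 * x.2.1 ∈ Set.range g

/-- The homogeneous matrix of degree `h` with entries `t γ` in the row of `γ`. -/
noncomputable def rowMatrix (K : Type*) [Field K] {G : Type*} [Group G] {n : ℕ} (g : Fin n → G) (h : G)
    (t : G → K) : Matrix (Fin n) (Fin n) K :=
  open Classical in Matrix.of fun i j => if g i * h = g j then t (g i) else 0

lemma rowMatrix_mem (h : G) (t : G → K) : rowMatrix K g h t ∈ elementary K g h := by
  classical
  exact mem_elementary.2 fun i j hij => (ite_ne_right_iff.1 hij).1

lemma exists_eq_rowMatrix (hg : Function.Injective g) {h : G} {A : Matrix (Fin n) (Fin n) K}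
    (hA : A ∈ elementary K g h) : ∃ t : G → K, A = rowMatrix K g h t := by
  classical
  -- The row sum is the only entry that can be nonzero; the value 0 off the image of `g` is never
  -- read.
  refine ⟨Function.extend g (fun i => ∑ j, A i j) 0, ?_⟩
  rw [mem_elementary] at hA
  ext i j
  rw [rowMatrix, Matrix.of_apply, hg.extend_apply]
  split_ifs with hij
  · refine (Finset.sum_eq_single j (fun k _ hk => ?_) (by simp)).symm
    by_contra h0
    exact hk (hg ((hA i k h0).symm.trans hij))
  · by_contra h0
    exact hij (hA i j h0)

open Classical in
/-- The entries of a product of homogeneous matrices depend only on the edges of walks. -/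
lemma prod_rowMatrix_apply (hg : Function.Injective g) (t : G × (G × ℕ) → K)
    (w : List (G × ℕ)) (i j : Fin n) :
    (w.map fun x => rowMatrix K g x.1 fun γ => t (γ, x)).prod i j =
      if Stays g (edges (g i) w) ∧ g i * wordDegree w = g j then
        ((edges (g i) w).map t).prod else 0 := by
  induction w generalizing i with
  | nil => simp [Stays, Matrix.one_apply, hg.eq_iff]
  | cons x w ih =>
    rw [List.map_cons, List.prod_cons, Matrix.mul_apply]
    by_cases hk : ∃ k, g k = g i * x.1
    · obtain ⟨k, hk⟩ := hk
      rw [Finset.sum_eq_single k, ih]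
      · simp [rowMatrix, Stays, ← hk, ← mul_assoc]
      · intro l _ hl
        have : g i * x.1 ≠ g l := fun h => hl (hg (by rw [← h, hk]))
        simp [rowMatrix, this]
      · simp
    · rw [Finset.sum_eq_zero, if_neg]
      · rintro ⟨h, -⟩
        exact hk (h _ (Multiset.mem_cons_self _ _))
      · intro l _
        have : g i * x.1 ≠ g l := fun h => hk ⟨l, h.symm⟩
        simp [rowMatrix, this]

open Classical in
lemma exists_lift_monomial_apply (hg : Function.Injective g)
    {a : G × ℕ → Matrix (Fin n) (Fin n) K} (ha : ∀ x, a x ∈ elementary K g x.1) :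
    ∃ t : G × (G × ℕ) → K, ∀ w i j, FreeAlgebra.lift K a (monomial K w) i j =
      if Stays g (edges (g i) w) ∧ g i * wordDegree w = g j then
        ((edges (g i) w).map t).prod else 0 := by
  choose t ht using fun x => exists_eq_rowMatrix hg (ha x)
  refine ⟨fun e => t e.2 e.1, fun w i j => ?_⟩
  rw [lift_monomial, ← prod_rowMatrix_apply hg]
  simp only [← ht]

/-- Words whose walks have the same edges from every vertex have the same values. -/
lemma monomial_sub_monomial_mem_gradedIdentities (hg : Function.Injective g)
    {u w : List (G × ℕ)} (hd : wordDegree u = wordDegree w) (he : ∀ γ, edges γ u = edges γ w) :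
    monomial K u - monomial K w ∈ gradedIdentities (elementary K g) := by
  intro a ha
  obtain ⟨t, ht⟩ := exists_lift_monomial_apply hg ha
  rw [map_sub, sub_eq_zero]
  ext i j
  rw [ht, ht, hd, he]

/-- A monomial is an identity if all its walks starting in the image of `g` leave this image. -/
lemma monomial_mem_gradedIdentities (hg : Function.Injective g) {w : List (G × ℕ)}
    (h : ∀ i, ¬ Stays g (edges (g i) w)) :
    monomial K w ∈ gradedIdentities (elementary K g) := by
  intro a ha
  obtain ⟨t, ht⟩ := exists_lift_monomial_apply hg ha
  ext i j
  simp [ht, h]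

/-- In a graded identity, the coefficients of the words with given edges of the walk from `g i`
add up to zero. -/
lemma sum_coeff_eq_zero [Infinite K] (hg : Function.Injective g) {s : Finset (List (G × ℕ))}
    {c : List (G × ℕ) → K}
    (hf : ∑ w ∈ s, c w • monomial K w ∈ gradedIdentities (elementary K g)) (i : Fin n)
    {e : Multiset (G × (G × ℕ))} (he : Stays g e) [DecidablePred fun w => edges (g i) w = e] :
    ∑ w ∈ s with edges (g i) w = e, c w = 0 := by
  classical
  -- The sum of row `i` of the generic value, with one indeterminate per edge. Its vanishing at all
  -- points makes it zero because `K` is infinite.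
  let P : MvPolynomial (G × (G × ℕ)) K := ∑ w ∈ s, if Stays g (edges (g i) w) then
    MvPolynomial.monomial (Multiset.toFinsupp (edges (g i) w)) (c w) else 0
  have hP : P = 0 := by
    refine MvPolynomial.funext fun t => ?_
    have h0 := hf (fun x => rowMatrix K g x.1 fun γ => t (γ, x)) fun x => rowMatrix_mem _ _
    have h1 := congrArg (fun A => ∑ j, A i j) h0
    simp only [map_sum, map_smul, lift_monomial, Matrix.sum_apply, Matrix.smul_apply,
      prod_rowMatrix_apply hg] at h1
    rw [Finset.sum_comm] at h1
    simp only [Matrix.zero_apply, Finset.sum_const_zero] at h1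
    rw [map_zero, ← h1, map_sum]
    refine Finset.sum_congr rfl fun w _ => ?_
    split_ifs with hw
    -- A walk that stays ends at some `g j`, so exactly one column contributes to the row sum.
    · obtain ⟨j, hj⟩ : ∃ j, g i * wordDegree w = g j := by
        rcases List.eq_nil_or_concat w with rfl | ⟨v, x, rfl⟩
        · exact ⟨i, by simp⟩
        · obtain ⟨j, hj⟩ := hw (g i * wordDegree v, x) (by simp [edges_append])
          exact ⟨j, by simp [hj, mul_assoc]⟩
      rw [Finset.sum_eq_single j]
      · simp [hw, hj, MvPolynomial.eval_monomial, Finsupp.prod, Finset.prod_multiset_map_count]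
      · intro k _ hk
        have : g i * wordDegree w ≠ g k := fun h => hk (hg (h.symm.trans hj))
        simp [this]
      · simp
    · simp [hw]
  have h2 := congrArg (MvPolynomial.coeff (Multiset.toFinsupp e)) hP
  simp only [P, MvPolynomial.coeff_sum, MvPolynomial.coeff_zero] at h2
  rw [Finset.sum_filter]
  refine Eq.trans ?_ h2
  refine Finset.sum_congr rfl fun w _ => ?_
  by_cases hw : edges (g i) w = e
  · simp [hw, he]
  · simp only [hw, if_false]
    split_ifs
    · simp [MvPolynomial.coeff_monomial, hw]
    · simp

end Evaluation

/-! ### Generated `T_G`-ideals and the ideal of identities. -/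

section TGIdeals

variable {K : Type*} [Field K] {G : Type*} [Group G] {S : Set (FreeGraded K G)}

lemma subset_tgSpan {f : FreeGraded K G} (hf : f ∈ S) : f ∈ tgSpan S :=
  (TwoSidedIdeal.mem_sInf _).2 fun _ hI => hI.2 f hf

lemma isTGIdeal_tgSpan (S : Set (FreeGraded K G)) : IsTGIdeal (tgSpan S) := by
  intro φ hφ f hf
  exact (TwoSidedIdeal.mem_sInf _).2 fun I hI => hI.1 φ hφ f ((TwoSidedIdeal.mem_sInf _).1 hf I hI)

lemma lift_mem_tgSpan {b : G × ℕ → FreeGraded K G} (hb : ∀ x, b x ∈ freeComponent K x.1)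
    {f : FreeGraded K G} (hf : f ∈ tgSpan S) : FreeAlgebra.lift K b f ∈ tgSpan S :=
  isTGIdeal_tgSpan S _ (isGradedEnd_lift hb) f hf

lemma smul_mem_tgSpan (c : K) {f : FreeGraded K G} (hf : f ∈ tgSpan S) : c • f ∈ tgSpan S := by
  rw [Algebra.smul_def]
  exact TwoSidedIdeal.mul_mem_left _ _ _ hf

lemma sum_mem_tgSpan {ι : Type*} {s : Finset ι} {f : ι → FreeGraded K G}
    (hf : ∀ i ∈ s, f i ∈ tgSpan S) : ∑ i ∈ s, f i ∈ tgSpan S :=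
  sum_mem hf

/-- Homogeneous elements of a degree whose variables lie in a `T_G`-ideal lie in it. -/
lemma mem_tgSpan_of_var_mem {h : G} {i : ℕ} (hv : var K h i ∈ tgSpan S) {f : FreeGraded K G}
    (hf : f ∈ freeComponent K h) : f ∈ tgSpan S := by
  classical
  have := lift_mem_tgSpan (b := Function.update (FreeAlgebra.ι K) (h, i) f) ?_ hv
  · simpa [var] using this
  · intro x
    by_cases hx : x = (h, i)
    · subst hx
      simpa using hf
    · simpa [hx] using ι_mem_freeComponent x

variable {n : ℕ} (g : Fin n → G)

/-- The graded identities of an elementary grading form an ideal. -/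
def identityIdeal (K : Type*) [Field K] {G : Type*} [Group G] {n : ℕ} (g : Fin n → G) :
    TwoSidedIdeal (FreeGraded K G) :=
  TwoSidedIdeal.mk' (gradedIdentities (elementary K g))
    (fun a _ => map_zero _)
    (fun hx hy a ha => by rw [map_add, hx a ha, hy a ha, add_zero])
    (fun hx a ha => by rw [map_neg, hx a ha, neg_zero])
    (fun hy a ha => by rw [map_mul, hy a ha, mul_zero])
    (fun hx a ha => by rw [map_mul, hx a ha, zero_mul])

lemma mem_identityIdeal {f : FreeGraded K G} :
    f ∈ identityIdeal K g ↔ f ∈ gradedIdentities (elementary K g) :=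
  TwoSidedIdeal.mem_mk' _ _ _ _ _ _ _

/-- Evaluating `φ f` at `a` is evaluating `f` at the values of the `φ x`, which are again
homogeneous of the right degrees. -/
lemma isTGIdeal_identityIdeal : IsTGIdeal (identityIdeal K g) := by
  intro φ hφ f hf
  rw [mem_identityIdeal] at hf ⊢
  intro a ha
  have hcomp : (FreeAlgebra.lift K a).comp φ =
      FreeAlgebra.lift K fun x => FreeAlgebra.lift K a (φ (FreeAlgebra.ι K x)) := by
    ext x
    simp
  rw [← AlgHom.comp_apply, hcomp]
  exact hf _ fun x => lift_mem_of_mem_freeComponent _ one_mem_elementary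
    (fun _ _ _ _ => mul_mem_elementary) ha (hφ _ _ (ι_mem_freeComponent x))

lemma tgSpan_subset_gradedIdentities (hS : S ⊆ gradedIdentities (elementary K g))
    {f : FreeGraded K G} (hf : f ∈ tgSpan S) : f ∈ gradedIdentities (elementary K g) :=
  (mem_identityIdeal g).1 <| (TwoSidedIdeal.mem_sInf _).1 hf _
    ⟨isTGIdeal_identityIdeal g, fun _ hf => (mem_identityIdeal g).2 (hS hf)⟩

end TGIdeals

/-! ### Consequences of the relations 1 and 2. -/

section Relations

variable {K : Type*} [Field K] {G : Type*} [Group G] {S : Set (FreeGraded K G)}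

lemma commute_mod_tgSpan (hS : neutralCommutators K G ⊆ S) {a b : FreeGraded K G}
    (ha : a ∈ freeComponent K (1 : G)) (hb : b ∈ freeComponent K (1 : G)) :
    a * b - b * a ∈ tgSpan S := by
  classical
  have := lift_mem_tgSpan (b := fun x : G × ℕ => if x = (1, 1) then a else
    if x = (1, 2) then b else FreeAlgebra.ι K x) ?_ (subset_tgSpan (hS rfl))
  · simpa [var] using this
  · intro x
    split_ifs with h₁ h₂
    · simpa [h₁] using ha
    · simpa [h₂] using hb
    · exact ι_mem_freeComponent x

/-- The indices 1, 2, 3 keep the three substituted variables distinct even when `h = h⁻¹`. -/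
lemma exchange_mod_tgSpan (hS : inverseDegreeRelations K G ⊆ S) {h : G} (hh : h ≠ 1)
    {a b c : FreeGraded K G} (ha : a ∈ freeComponent K h) (hb : b ∈ freeComponent K h⁻¹)
    (hc : c ∈ freeComponent K h) : a * b * c - c * b * a ∈ tgSpan S := by
  classical
  have := lift_mem_tgSpan (b := fun x : G × ℕ => if x = (h, 1) then a else
    if x = (h⁻¹, 3) then b else if x = (h, 2) then c else FreeAlgebra.ι K x) ?_
    (subset_tgSpan (hS ⟨h, hh, rfl⟩))
  · simpa [var] using this
  · intro x
    split_ifs with h₁ h₂ h₃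
    · simpa [h₁] using ha
    · simpa [h₂] using hb
    · simpa [h₃] using hc
    · exact ι_mem_freeComponent x

lemma monomial_exchange (h₁ : neutralCommutators K G ⊆ S) (h₂ : inverseDegreeRelations K G ⊆ S)
    {p q r : List (G × ℕ)} (hr : wordDegree p = wordDegree r)
    (hq : wordDegree p * wordDegree q = 1) :
    monomial K (p ++ q ++ r) - monomial K (r ++ q ++ p) ∈ tgSpan S := by
  have mp := monomial_mem_freeComponent (K := K) p
  have mq := monomial_mem_freeComponent (K := K) q
  have mr := monomial_mem_freeComponent (K := K) r
  rw [← hr] at mr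
  rw [← inv_eq_of_mul_eq_one_right hq] at mq
  simp only [monomial_append]
  by_cases h : wordDegree p = 1
  -- In neutral degree, `pqr - rqp = (p(qr) - (qr)p) + (qr - rq)p`.
  · simp only [h, inv_one] at mp mq mr
    have e₁ := commute_mod_tgSpan h₁ mp (by simpa using mul_mem_freeComponent mq mr)
    have e₂ := TwoSidedIdeal.mul_mem_right _ _ (monomial K p) (commute_mod_tgSpan h₁ mq mr)
    have := TwoSidedIdeal.add_mem _ e₁ e₂
    convert this using 1
    noncomm_ring
  · exact exchange_mod_tgSpan h₂ h mp mq mr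

/-- Words whose walks from some vertex have the same edges are congruent modulo the relations
`x₁x₂ - x₂x₁` and `x₁x₃x₂ - x₂x₃x₁`. -/
theorem monomial_sub_mem_of_edges_eq (h₁ : neutralCommutators K G ⊆ S)
    (h₂ : inverseDegreeRelations K G ⊆ S) {γ : G} {u w : List (G × ℕ)}
    (h : edges γ u = edges γ w) : monomial K u - monomial K w ∈ tgSpan S := by
  refine rel_of_edges_eq (R := fun u w => monomial K u - monomial K w ∈ tgSpan S)
    ⟨fun u => ?_, fun {u w} h => ?_, fun {u v w} h h' => ?_⟩ (fun x u w h => ?_)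
    (fun u w s h => ?_) (fun p q r => monomial_exchange h₁ h₂) h
  · rw [sub_self]
    exact TwoSidedIdeal.zero_mem _
  · rw [← neg_sub]
    exact TwoSidedIdeal.neg_mem _ h
  · rw [← sub_add_sub_cancel]
    exact TwoSidedIdeal.add_mem _ h h'
  · rw [monomial_cons, monomial_cons, ← mul_sub]
    exact TwoSidedIdeal.mul_mem_left _ _ _ h
  · rw [monomial_append, monomial_append, ← sub_mul]
    exact TwoSidedIdeal.mul_mem_right _ _ _ h

variable {n : ℕ} {g : Fin n → G}

lemma neutralCommutators_subset (hg : Function.Injective g) :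
    neutralCommutators K G ⊆ gradedIdentities (elementary K g) := by
  rintro _ rfl
  simpa [var] using monomial_sub_monomial_mem_gradedIdentities (K := K) hg
    (u := [(1, 1), (1, 2)]) (w := [(1, 2), (1, 1)]) (by simp)
    (fun γ => by simpa using Multiset.pair_comm _ _)

lemma inverseDegreeRelations_subset (hg : Function.Injective g) :
    inverseDegreeRelations K G ⊆ gradedIdentities (elementary K g) := by
  rintro _ ⟨h, -, rfl⟩
  have := monomial_sub_monomial_mem_gradedIdentities (K := K) hg
    (u := [(h, 1)] ++ [(h⁻¹, 3)] ++ [(h, 2)]) (w := [(h, 2)] ++ [(h⁻¹, 3)] ++ [(h, 1)]) (by simp)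
    (fun γ => edges_exchange γ (by simp) (by simp))
  simpa [var, mul_assoc] using this

lemma zeroComponentVariables_subset :
    zeroComponentVariables (elementary K g) ⊆ gradedIdentities (elementary K g) := by
  rintro _ ⟨h, hh, rfl⟩ a ha
  simpa [var, hh] using ha (h, 1)

end Relations

/-! ### Cutting a word into few blocks. -/

section Blocks

variable {G : Type*} [Group G] {n : ℕ} {g : Fin n → G}

lemma not_stays_iff {w : List (G × ℕ)} {i : Fin n} :
    ¬ Stays g (edges (g i) w) ↔ ∃ u v, w = u ++ v ∧ g i * wordDegree u ∉ Set.range g := by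
  constructor
  · intro h
    obtain ⟨e, he, hr⟩ : ∃ e ∈ edges (g i) w, e.1 * e.2.1 ∉ Set.range g := by
      simpa only [Stays, not_forall, exists_prop] using h
    obtain ⟨u, v, rfl, hu⟩ := mem_edges.1 he
    refine ⟨u ++ [e.2], v, by simp, ?_⟩
    rw [← hu] at hr
    simpa [mul_assoc] using hr
  · rintro ⟨u, v, rfl, hu⟩ h
    rcases List.eq_nil_or_concat u with rfl | ⟨u, x, rfl⟩
    · simp at hu
    · refine hu ?_
      have := h (g i * wordDegree u, x) (by simp [edges_append])
      simpa [mul_assoc] using this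

/-- The prefixes of a word whose degrees move the vertices of a finite set out of the image of `g`
are unions of blocks in a subdivision of the word into few blocks. -/
lemma exists_blocks {w : List (G × ℕ)} (F : Finset (Fin n))
    (hF : ∀ i ∈ F, ¬ Stays g (edges (g i) w)) :
    ∃ L : List (List (G × ℕ)), L.flatten = w ∧ 2 ≤ L.length ∧ L.length ≤ F.card + 2 ∧
      ∀ i ∈ F, ∃ P Q, L = P ++ Q ∧ g i * wordDegree P.flatten ∉ Set.range g := by
  induction F using Finset.cons_induction with
  -- The empty block secures the lower bound 2 on the length.
  | empty => exact ⟨[[], w], by simp, by simp, by simp, by simp⟩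
  | cons i F hi ih =>
    obtain ⟨L, hL, h₂, hF', hP⟩ := ih fun j hj => hF j (Finset.mem_cons_of_mem hj)
    obtain ⟨u, v, huv, hu⟩ := not_stays_iff.1 (hF i (Finset.mem_cons_self i F))
    rw [Finset.card_cons]
    -- The new cut is an existing one or splits one block in two; the old cuts survive.
    rcases List.flatten_eq_append_iff.1 (hL.trans huv) with
      ⟨A, B, rfl, rfl, rfl⟩ | ⟨A, b, x, c, B, rfl, rfl, rfl⟩
    · refine ⟨A ++ B, hL, h₂, by omega, fun j hj => ?_⟩
      rcases Finset.mem_cons.1 hj with rfl | hj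
      · exact ⟨A, B, rfl, hu⟩
      · exact hP j hj
    · refine ⟨A ++ b :: (x :: c) :: B, by simpa using hL, by simp; omega, ?_, fun j hj => ?_⟩
      · simp only [List.length_append, List.length_cons] at hF' ⊢
        omega
      rcases Finset.mem_cons.1 hj with rfl | hj
      · exact ⟨A ++ [b], (x :: c) :: B, by simp, by simpa using hu⟩
      · obtain ⟨P, Q, hPQ, hj⟩ := hP j hj
        rcases List.append_eq_append_iff.1 hPQ with ⟨D, rfl, hD⟩ | ⟨D, rfl, hD⟩
        · cases D with
          | nil => exact ⟨A, _, rfl, by simpa using hj⟩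
          | cons d D =>
            obtain ⟨rfl, rfl⟩ := List.cons_eq_cons.1 hD
            exact ⟨A ++ b :: (x :: c) :: D, Q, by simp, by simpa using hj⟩
        · exact ⟨P, D ++ b :: (x :: c) :: B, by simp, hj⟩

/-- The word with one variable for each block, of the degree of the block. -/
def blockWord : List (List (G × ℕ)) → ℕ → List (G × ℕ)
  | [], _ => []
  | b :: L, k => (wordDegree b, k) :: blockWord L (k + 1)

@[simp] lemma length_blockWord (L : List (List (G × ℕ))) (k : ℕ) :
    (blockWord L k).length = L.length := by
  induction L generalizing k with
  | nil => rfl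
  | cons b L ih => simp [blockWord, ih]

lemma wordDegree_blockWord (L : List (List (G × ℕ))) (k : ℕ) :
    wordDegree (blockWord L k) = wordDegree L.flatten := by
  induction L generalizing k with
  | nil => rfl
  | cons b L ih => simp [blockWord, ih]

lemma blockWord_append (P Q : List (List (G × ℕ))) (k : ℕ) :
    blockWord (P ++ Q) k = blockWord P k ++ blockWord Q (k + P.length) := by
  induction P generalizing k with
  | nil => rfl
  | cons b P ih => simp [blockWord, ih, add_assoc, add_comm 1]

/-- The lower index bound makes the variable of each block new with respect to later ones; the upper
bound keeps the alphabet finite. -/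
lemma mem_blockWord {L : List (List (G × ℕ))} {k : ℕ} {x : G × ℕ} (hx : x ∈ blockWord L k) :
    (∃ b ∈ L, wordDegree b = x.1) ∧ k ≤ x.2 ∧ x.2 < k + L.length := by
  induction L generalizing k with
  | nil => simp [blockWord] at hx
  | cons b L ih =>
    rcases List.mem_cons.1 hx with rfl | hx
    · simp
    · obtain ⟨⟨c, hc, hcx⟩, h₁, h₂⟩ := ih hx
      refine ⟨⟨c, List.mem_cons_of_mem _ hc, hcx⟩, by omega, ?_⟩
      rw [List.length_cons]
      omega

/-- A homogeneous substitution maps the block word to the original word. -/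
lemma exists_lift_blockWord (K : Type*) [Field K] (L : List (List (G × ℕ))) (k : ℕ) :
    ∃ b : G × ℕ → FreeGraded K G, (∀ x, b x ∈ freeComponent K x.1) ∧
      FreeAlgebra.lift K b (monomial K (blockWord L k)) = monomial K L.flatten := by
  classical
  induction L generalizing k with
  | nil => exact ⟨FreeAlgebra.ι K, ι_mem_freeComponent, by simp [blockWord]⟩
  | cons c L ih =>
    obtain ⟨b, hb, hL⟩ := ih (k + 1)
    refine ⟨Function.update b (wordDegree c, k) (monomial K c), fun x => ?_, ?_⟩
    · by_cases hx : x = (wordDegree c, k)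
      · subst hx
        simpa using monomial_mem_freeComponent c
      · simpa [hx] using hb x
    · rw [lift_monomial] at hL
      rw [blockWord, monomial_cons, map_mul, lift_monomial, FreeAlgebra.lift_ι_apply,
        Function.update_self, List.flatten_cons, monomial_append, ← hL]
      congr 2
      refine List.map_congr_left fun x hx => Function.update_of_ne ?_ _ _
      rintro rfl
      have := (mem_blockWord hx).2.1
      simp at this

end Blocks

/-! ### The basis of identities. -/

section Basis

variable {K : Type*} [Field K] {G : Type*} [Group G] {n : ℕ} {g : Fin n → G}

/-- The monomial identities of length between `2` and `n + 2` in finitely many variables. -/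
def shortMonomialIdentities (K : Type*) [Field K] {G : Type*} [Group G] {n : ℕ} (g : Fin n → G) :
    Set (List (G × ℕ)) :=
  {w | 2 ≤ w.length ∧ w.length ≤ n + 2 ∧
    (∀ x ∈ w, x ∈ Set.range (fun p : Fin n × Fin n => (g p.1)⁻¹ * g p.2) ×ˢ Set.Iio (n + 2)) ∧
    monomial K w ∈ gradedIdentities (elementary K g)}

lemma finite_shortMonomialIdentities : (shortMonomialIdentities K g).Finite := by
  set V := Set.range (fun p : Fin n × Fin n => (g p.1)⁻¹ * g p.2) ×ˢ Set.Iio (n + 2)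
  have hV : V.Finite := (Set.finite_range _).prod (Set.finite_Iio _)
  have : Finite V := hV
  refine ((List.finite_length_le V (n + 2)).image (List.map Subtype.val)).subset ?_
  rintro w ⟨-, hw, hV, -⟩
  lift w to List V using hV
  exact ⟨w, by simpa using hw, rfl⟩

/-- A monomial identity lies in the `T_G`-ideal generated by the variables of zero components and
the short monomial identities. -/
lemma monomial_mem_tgSpan (hg : Function.Injective g) {S : Set (FreeGraded K G)}
    (h₃ : zeroComponentVariables (elementary K g) ⊆ S)
    (h₄ : monomial K '' shortMonomialIdentities K g ⊆ S) {w : List (G × ℕ)}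
    (hw : ∀ i, ¬ Stays g (edges (g i) w)) : monomial K w ∈ tgSpan S := by
  obtain ⟨L, rfl, h₂, hn, hP⟩ := exists_blocks Finset.univ fun i _ => hw i
  -- A block whose degree has zero component is handled by relation 3; otherwise all block degrees
  -- have the form `(g i)⁻¹ * g j`, and the block word is itself a short identity.
  by_cases hL : ∃ b ∈ L, ∀ i j, g i * wordDegree b ≠ g j
  · obtain ⟨b, hb, hij⟩ := hL
    have hbS : monomial K b ∈ tgSpan S := mem_tgSpan_of_var_mem
      (subset_tgSpan (h₃ ⟨_, elementary_eq_bot hij, rfl⟩)) (monomial_mem_freeComponent b)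
    obtain ⟨P, Q, rfl⟩ := List.append_of_mem hb
    rw [List.flatten_append, List.flatten_cons, monomial_append, monomial_append]
    exact TwoSidedIdeal.mul_mem_left _ _ _ (TwoSidedIdeal.mul_mem_right _ _ _ hbS)
  · push Not at hL
    rw [Finset.card_univ, Fintype.card_fin] at hn
    obtain ⟨b, hb, hbL⟩ := exists_lift_blockWord K L 0
    rw [← hbL]
    refine lift_mem_tgSpan hb (subset_tgSpan (h₄ ⟨_, ⟨by simpa, by simpa, fun x hx => ?_, ?_⟩, rfl⟩))
    · obtain ⟨⟨b, hb, hbx⟩, -, hx⟩ := mem_blockWord hx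
      obtain ⟨i, j, hij⟩ := hL b hb
      exact ⟨⟨(i, j), by simp [← hij, hbx]⟩, by simp only [Set.mem_Iio]; omega⟩
    · refine monomial_mem_gradedIdentities hg fun i => ?_
      obtain ⟨P, Q, rfl, hi⟩ := hP i (Finset.mem_univ i)
      exact not_stays_iff.2 ⟨_, _, blockWord_append P Q 0, by rwa [wordDegree_blockWord]⟩

/-- Part of the sum, either one monomial identity or one class of words with equal edges, is shown
to lie in `tgSpan S` and is removed; the rest is a shorter identity. -/
lemma sum_monomial_mem_tgSpan [Infinite K] (hg : Function.Injective g) {S : Set (FreeGraded K G)}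
    (hS : S ⊆ gradedIdentities (elementary K g))
    (h₁ : neutralCommutators K G ⊆ S) (h₂ : inverseDegreeRelations K G ⊆ S)
    (hmon : ∀ w, (∀ i, ¬ Stays g (edges (g i) w)) → monomial K w ∈ tgSpan S)
    (c : List (G × ℕ) → K) (s : Finset (List (G × ℕ)))
    (hf : ∑ w ∈ s, c w • monomial K w ∈ gradedIdentities (elementary K g)) :
    ∑ w ∈ s, c w • monomial K w ∈ tgSpan S := by
  classical
  induction s using Finset.strongInduction with
  | H s ih =>
    rcases s.eq_empty_or_nonempty with rfl | ⟨w, hw⟩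
    · simp
    obtain ⟨t, hts, hwt, ht⟩ : ∃ t ⊆ s, w ∈ t ∧ ∑ v ∈ t, c v • monomial K v ∈ tgSpan S := by
      by_cases hst : ∀ i, ¬ Stays g (edges (g i) w)
      · refine ⟨{w}, by simpa, by simp, ?_⟩
        rw [Finset.sum_singleton]
        exact smul_mem_tgSpan _ (hmon w hst)
      · push Not at hst
        obtain ⟨i, hi⟩ := hst
        refine ⟨{v ∈ s | edges (g i) v = edges (g i) w}, Finset.filter_subset _ _, by simpa, ?_⟩
        -- Since these coefficients sum to zero, `monomial K w` can be subtracted from every term.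
        have h0 := sum_coeff_eq_zero hg hf i hi
        have : ∑ v ∈ s with edges (g i) v = edges (g i) w, c v • monomial K v =
            ∑ v ∈ s with edges (g i) v = edges (g i) w, c v • (monomial K v - monomial K w) := by
          simp only [smul_sub, Finset.sum_sub_distrib, ← Finset.sum_smul, h0, zero_smul, sub_zero]
        rw [this]
        exact sum_mem_tgSpan fun v hv => smul_mem_tgSpan _
          (monomial_sub_mem_of_edges_eq h₁ h₂ (Finset.mem_filter.1 hv).2)
    have hsum := Finset.sum_sdiff (f := fun v => c v • monomial K v) hts
    rw [← hsum]
    refine TwoSidedIdeal.add_mem _ (ih _ ?_ ?_) ht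
    · exact Finset.sdiff_ssubset hts ⟨w, hwt⟩
    · rw [← eq_sub_iff_add_eq] at hsum
      rw [hsum]
      rw [← mem_identityIdeal] at hf ⊢
      exact TwoSidedIdeal.sub_mem _ hf
        ((mem_identityIdeal g).2 (tgSpan_subset_gradedIdentities g hS ht))

lemma exists_eq_sum_monomial {G : Type*} (f : FreeGraded K G) :
    ∃ (s : Finset (List (G × ℕ))) (c : List (G × ℕ) → K), f = ∑ w ∈ s, c w • monomial K w := by
  have hf : f ∈ Submodule.span K (Set.range (monomial K (G := G))) := by
    induction f using FreeAlgebra.induction with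
    | grade0 r =>
      rw [Algebra.algebraMap_eq_smul_one]
      exact Submodule.smul_mem _ _ (Submodule.subset_span ⟨[], rfl⟩)
    | grade1 x => exact Submodule.subset_span ⟨[x], by simp⟩
    | add a b ha hb => exact Submodule.add_mem _ ha hb
    | mul a b ha hb =>
      have := Submodule.mul_mem_mul ha hb
      rw [Submodule.span_mul_span] at this
      refine Submodule.span_mono ?_ this
      rintro _ ⟨_, ⟨u, rfl⟩, _, ⟨v, rfl⟩, rfl⟩
      exact ⟨u ++ v, monomial_append u v⟩
  obtain ⟨c, rfl⟩ := Finsupp.mem_span_range_iff_exists_finsupp.1 hf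
  exact ⟨c.support, c, rfl⟩

theorem isBasisOfIdentities_shortMonomialIdentities [Infinite K] (hg : Function.Injective g) :
    IsBasisOfIdentities (elementary K g)
      (neutralCommutators K G ∪ inverseDegreeRelations K G ∪
        zeroComponentVariables (elementary K g) ∪ monomial K '' shortMonomialIdentities K g) := by
  set S := neutralCommutators K G ∪ inverseDegreeRelations K G ∪
    zeroComponentVariables (elementary K g) ∪ monomial K '' shortMonomialIdentities K g with hSdef
  have hS : S ⊆ gradedIdentities (elementary K g) := by
    refine Set.union_subset (Set.union_subset (Set.union_subset (neutralCommutators_subset hg)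
      (inverseDegreeRelations_subset hg)) zeroComponentVariables_subset) ?_
    rintro _ ⟨w, hw, rfl⟩
    exact hw.2.2.2
  refine Set.Subset.antisymm (fun f hf => ?_) fun f hf => tgSpan_subset_gradedIdentities g hS hf
  obtain ⟨s, c, rfl⟩ := exists_eq_sum_monomial f
  refine sum_monomial_mem_tgSpan hg hS (fun x hx => ?_) (fun x hx => ?_)
    (fun w => monomial_mem_tgSpan hg (fun x hx => ?_) fun x hx => ?_) c s hf <;>
  simp [hSdef, hx]

end Basis

end GradedPI

theorem theorem1 {K : Type*} [Field K] [Infinite K] {G : Type*} [Group G]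
    (n : ℕ) (hn : 1 ≤ n) (g : Fin n → G) (hg : Function.Injective g) :
    ∃ M : Set (List (G × ℕ)), M.Finite ∧
      (∀ w ∈ M, 2 ≤ w.length ∧ w.length ≤ 4 * n ^ (4 * (n ^ 2 + 1))) ∧
      GradedPI.IsBasisOfIdentities (GradedPI.elementary K g)
        (GradedPI.neutralCommutators K G ∪ GradedPI.inverseDegreeRelations K G ∪
          GradedPI.zeroComponentVariables (GradedPI.elementary K g) ∪
          GradedPI.monomial K '' M) := by
  refine ⟨GradedPI.shortMonomialIdentities K g, GradedPI.finite_shortMonomialIdentities,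
    fun w hw => ⟨hw.1, hw.2.1.trans ?_⟩,
    GradedPI.isBasisOfIdentities_shortMonomialIdentities hg⟩
  -- The lengths are at most `n + 2`, and `n + 2 ≤ 4 * n` for `n ≥ 1`.
  have : n ≤ n ^ (4 * (n ^ 2 + 1)) := Nat.le_self_pow (by positivity) n
  omega
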